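/- Let $N \in \mathbb{N}$, let $1 < p \le N$ and $p \le q < p^*$, where $p^* = \frac{Np}{N-p}$ if $p < N$ and $p^* = +\infty$ if $p = N$ (so for $p = N$ every $q \ge p$ is allowed). Let $a^* > 0$, let $m_0 \ge 1$ be an integer, and let $a_0^* > 0$. Then there is a constant $C > 0$, depending only on $N, p, q, a^*, m_0, a_0^*$, such that the following holds for every bounded open set $\Omega \subset \mathbb{R}^N$ and every $u \in W_0^{1,p}(\Omega)$. Here $|D|$ is the Lebesgue measure of $D$ and $\|u\|_\Omega = \left(\int_\Omega |\nabla u|^p\,dx + \int_\Omega |u|^p\,dx\right)^{1/p}$. (i) For real $m$ put $\Omega_m^+ = \{x \in \Omega : u(x) > m\}$. If $$\int_{\Omega_m^+} |\nabla u|^p\,dx \le a^*\left(m^q\,|\Omega_m^+| + \int_{\Omega_m^+} |u|^q\,dx\right)\quad\text{for all real } m \ge m_0$$ and $\max\{|\Omega_{m_0}^+|, \|u\|_\Omega\} \le a_0^*$, then $\operatorname{ess\,sup}_\Omega u \le C$. (ii) For real $m$ put $\Omega_m^- = \{x \in \Omega : u(x) < -m\}$. If $$\int_{\Omega_m^-}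 |\nabla u|^p\,dx \le a^*\left(m^q\,|\Omega_m^-| + \int_{\Omega_m^-} |u|^q\,dx\right)\quad\text{for all real } m \ge m_0$$ and $\max\{|\Omega_{m_0}^-|, \|u\|_\Omega\} \le a_0^*$, then $\operatorname{ess\,sup}_\Omega (-u) \le C$. -/

import Mathlib

open MeasureTheory
open scoped ENNReal ContDiff

noncomputable section

/-- The critical Sobolev exponent `p^*`: it is `N p / (N - p)` if `p < N`, and `+∞` if `p ≥ N`. -/
def sobolevExponent (N : ℕ) (p : ℝ) : EReal :=
  if p < N then ((N * p / (N - p) : ℝ) : EReal) else ⊤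

/-- `φ ∈ C_c^∞(Ω)`. -/
structure IsTestFunction {N : ℕ} (Ω : Set (EuclideanSpace ℝ (Fin N)))
    (φ : EuclideanSpace ℝ (Fin N) → ℝ) : Prop where
  smooth : ContDiff ℝ ∞ φ
  compact_support : HasCompactSupport φ
  support_subset : tsupport φ ⊆ Ω

/-- `g` is the weak (distributional) gradient of `u` in `Ω`: both are locally integrable in `Ω` and
`∫_Ω u ∇φ dx = - ∫_Ω φ g dx` (an identity between vectors) for all `φ ∈ C_c^∞(Ω)`. -/
structure IsWeakGradient {N : ℕ} (Ω : Set (EuclideanSpace ℝ (Fin N)))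
    (u : EuclideanSpace ℝ (Fin N) → ℝ)
    (g : EuclideanSpace ℝ (Fin N) → EuclideanSpace ℝ (Fin N)) : Prop where
  locallyIntegrable : LocallyIntegrableOn u Ω volume
  locallyIntegrable_grad : LocallyIntegrableOn g Ω volume
  integral_eq : ∀ φ : EuclideanSpace ℝ (Fin N) → ℝ, IsTestFunction Ω φ →
    ∫ x in Ω, u x • gradient φ x = - ∫ x in Ω, φ x • g x

/-- The Sobolev norm `‖u‖_Ω = (∫_Ω |∇u|^p dx + ∫_Ω |u|^p dx)^{1/p}`, with `g` in the role of
`∇u` and with values in `[0, ∞]`. -/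
def sobolevNorm {N : ℕ} (Ω : Set (EuclideanSpace ℝ (Fin N))) (p : ℝ)
    (u : EuclideanSpace ℝ (Fin N) → ℝ)
    (g : EuclideanSpace ℝ (Fin N) → EuclideanSpace ℝ (Fin N)) : ℝ≥0∞ :=
  ((∫⁻ x in Ω, ‖g x‖ₑ ^ p) + ∫⁻ x in Ω, ‖u x‖ₑ ^ p) ^ (1 / p)

/-- `u ∈ W^{1,p}(Ω)`, with weak gradient `g`. -/
structure MemW1p {N : ℕ} (Ω : Set (EuclideanSpace ℝ (Fin N))) (p : ℝ)
    (u : EuclideanSpace ℝ (Fin N) → ℝ)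
    (g : EuclideanSpace ℝ (Fin N) → EuclideanSpace ℝ (Fin N)) : Prop where
  memLp : MemLp u (ENNReal.ofReal p) (volume.restrict Ω)
  memLp_grad : MemLp g (ENNReal.ofReal p) (volume.restrict Ω)
  isWeakGradient : IsWeakGradient Ω u g

/-- `u ∈ W_0^{1,p}(Ω)`, with weak gradient `g`: the function `u` belongs to the closure of
`C_c^∞(Ω)` in `W^{1,p}(Ω)`. -/
structure MemW01p {N : ℕ} (Ω : Set (EuclideanSpace ℝ (Fin N))) (p : ℝ)
    (u : EuclideanSpace ℝ (Fin N) → ℝ)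
    (g : EuclideanSpace ℝ (Fin N) → EuclideanSpace ℝ (Fin N)) : Prop where
  memW1p : MemW1p Ω p u g
  exists_approx : ∀ ε : ℝ≥0∞, 0 < ε → ∃ φ : EuclideanSpace ℝ (Fin N) → ℝ,
    IsTestFunction Ω φ ∧
      sobolevNorm Ω p (fun x => u x - φ x) (fun x => g x - gradient φ x) < ε

/-- `Ω_m^+ = {x ∈ Ω : u(x) > m}`. -/
def superlevel {N : ℕ} (Ω : Set (EuclideanSpace ℝ (Fin N)))
    (u : EuclideanSpace ℝ (Fin N) → ℝ) (m : ℝ) : Set (EuclideanSpace ℝ (Fin N)) :=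
  {x | x ∈ Ω ∧ m < u x}

/-- `Ω_m^- = {x ∈ Ω : u(x) < -m}`. -/
def sublevel {N : ℕ} (Ω : Set (EuclideanSpace ℝ (Fin N)))
    (u : EuclideanSpace ℝ (Fin N) → ℝ) (m : ℝ) : Set (EuclideanSpace ℝ (Fin N)) :=
  {x | x ∈ Ω ∧ u x < -m}

end

/-! For `m > 0` the truncation `(u - m)⁺` satisfies the Sobolev inequality with the gradient of `u`
restricted to the superlevel set: approximate `t ↦ (t - m)⁺` by `C¹` functions vanishing below `m`,
and `u` by test functions. With `W m = ‖(u - m)⁺‖_r` and an exponent `r > max p q`, this bounds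
`(W h) ^ p` by a multiple of the energy `∫_{u > h} |∇u| ^ p`, hence of
`h ^ q |{u > h}| + ∫_{u > h} |u| ^ q`. If `0 ≤ m < h ≤ t`, then `t ≤ h (t - m) / (h - m)`, so both
`h ^ q` and `t ^ q` are at most `h ^ q ((t - m) / (h - m)) ^ r`. Therefore
`(h - m) ^ r (W h) ^ p ≤ B h ^ q (W m) ^ r`. Since `r > p` the recursion is superlinear, and since
`r > q` it makes `W` vanish at a level depending only on the data. The lower bound for `u` is the
upper bound for `-u`.
-/

open Filter Set
open scoped NNReal Topology

/-! ### A `C¹` approximation of the positive part -/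

/-- A `C¹` approximation of the positive part `t ↦ max t 0`, converging to it as `ε → 0`. It is
`1`-Lipschitz and still vanishes on `(-∞, 0]`, so composing with it preserves compact supports. -/
noncomputable def smoothPosPart (ε t : ℝ) : ℝ := √(max t 0 ^ 2 + ε ^ 2) - ε

theorem hasDerivAt_max_zero_sq (t : ℝ) :
    HasDerivAt (fun t : ℝ ↦ max t 0 ^ 2) (2 * max t 0) t := by
  refine hasDerivAt_of_hasDerivAt_of_ne' (x := 0) (f := fun t ↦ max t 0 ^ 2)
    (g := fun t ↦ 2 * max t 0) (fun y hy ↦ ?_) (by fun_prop) (by fun_prop) t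
  rcases hy.lt_or_gt with hneg | hpos
  · rw [max_eq_right hneg.le, mul_zero]
    refine (hasDerivAt_const y (0 : ℝ)).congr_of_eventuallyEq ?_
    filter_upwards [eventually_lt_nhds hneg] with x hx
    rw [max_eq_right hx.le, zero_pow two_ne_zero]
  · rw [max_eq_left hpos.le]
    have hsq : HasDerivAt (fun t : ℝ ↦ t ^ 2) (2 * y) y := by simpa using hasDerivAt_pow 2 y
    refine hsq.congr_of_eventuallyEq ?_
    filter_upwards [eventually_gt_nhds hpos] with x hx
    rw [max_eq_left hx.le]

section SmoothPosPart

variable {ε : ℝ}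

theorem hasDerivAt_smoothPosPart (hε : 0 < ε) (t : ℝ) :
    HasDerivAt (smoothPosPart ε) (max t 0 / √(max t 0 ^ 2 + ε ^ 2)) t := by
  have hne : max t 0 ^ 2 + ε ^ 2 ≠ 0 := by positivity
  convert! (((hasDerivAt_max_zero_sq t).add_const (ε ^ 2)).sqrt hne).sub_const ε using 1
  rw [mul_div_mul_left _ _ two_ne_zero]

theorem deriv_smoothPosPart (hε : 0 < ε) :
    deriv (smoothPosPart ε) = fun t ↦ max t 0 / √(max t 0 ^ 2 + ε ^ 2) :=
  funext fun t ↦ (hasDerivAt_smoothPosPart hε t).deriv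

theorem contDiff_smoothPosPart (hε : 0 < ε) : ContDiff ℝ 1 (smoothPosPart ε) := by
  refine contDiff_one_iff_deriv.2
    ⟨fun t ↦ (hasDerivAt_smoothPosPart hε t).differentiableAt, ?_⟩
  rw [deriv_smoothPosPart hε]
  exact Continuous.div (by fun_prop) (by fun_prop) fun t ↦ by positivity

theorem smoothPosPart_of_nonpos (hε : 0 < ε) {t : ℝ} (ht : t ≤ 0) : smoothPosPart ε t = 0 := by
  simp [smoothPosPart, max_eq_right ht, Real.sqrt_sq hε.le]

theorem deriv_smoothPosPart_of_nonpos (hε : 0 < ε) {t : ℝ} (ht : t ≤ 0) :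
    deriv (smoothPosPart ε) t = 0 := by
  simp [deriv_smoothPosPart hε, max_eq_right ht]

theorem abs_deriv_smoothPosPart_le_one (hε : 0 < ε) (t : ℝ) :
    |deriv (smoothPosPart ε) t| ≤ 1 := by
  rw [deriv_smoothPosPart hε, abs_of_nonneg (by positivity)]
  refine div_le_one_of_le₀ (Real.le_sqrt_of_sq_le ?_) (Real.sqrt_nonneg _)
  exact le_add_of_nonneg_right (sq_nonneg ε)

theorem tendsto_smoothPosPart (t : ℝ) :
    Tendsto (fun ε ↦ smoothPosPart ε t) (𝓝 0) (𝓝 (max t 0)) := by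
  have hcont : Continuous fun ε ↦ smoothPosPart ε t := by unfold smoothPosPart; fun_prop
  simpa [smoothPosPart, Real.sqrt_sq] using hcont.tendsto 0

end SmoothPosPart

/-! ### De Giorgi iteration -/

theorem le_geometric_of_rpow_le {p r b c K l : ℝ} {x : ℕ → ℝ} (hp : 0 < p) (hpr : p ≤ r)
    (hb : 0 ≤ b) (hc : 0 ≤ c) (hK : 0 ≤ K) (hl : 0 ≤ l) (hbl : b * l ^ (r - p) ≤ 1)
    (hcK : c * K ^ (r - p) ≤ l ^ p) (hx : ∀ j, 0 ≤ x j) (h0 : x 0 ≤ K)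
    (hstep : ∀ j, x (j + 1) ^ p ≤ c * b ^ j * x j ^ r) (j : ℕ) : x j ≤ K * l ^ j := by
  induction j with
  | zero => simpa using h0
  | succ j ih =>
    have hsplit : (K * l ^ j) ^ r = K ^ (r - p) * (l ^ (r - p)) ^ j * (K * l ^ j) ^ p := by
      rw [Real.rpow_pow_comm hl, ← Real.mul_rpow hK (by positivity),
        ← Real.rpow_add_of_nonneg (by positivity) (sub_nonneg.2 hpr) hp.le, sub_add_cancel]
    refine (Real.rpow_le_rpow_iff (hx _) (by positivity) hp).1 ?_
    calc x (j + 1) ^ p ≤ c * b ^ j * x j ^ r := hstep j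
      _ ≤ c * b ^ j * (K * l ^ j) ^ r := by
        gcongr
        · exact hx j
        · exact hp.le.trans hpr
      _ = c * K ^ (r - p) * (b * l ^ (r - p)) ^ j * (K * l ^ j) ^ p := by
        rw [hsplit, mul_pow]; ring
      _ ≤ l ^ p * 1 * (K * l ^ j) ^ p := by
        gcongr
        exact pow_le_one₀ (by positivity) hbl
      _ = (K * l ^ (j + 1)) ^ p := by
        rw [mul_one, ← Real.mul_rpow hl (by positivity)]; congr 1; ring

/-- The levels `M (2 - 2⁻ʲ)` of the De Giorgi iteration, increasing from `M` to `2 M`. -/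
noncomputable def deGiorgiLevel (M : ℝ) (j : ℕ) : ℝ := M * (2 - (1 / 2) ^ j)

section DeGiorgi

variable {M p q r B K m₀ : ℝ}

theorem deGiorgiLevel_mem_Icc (hM : 0 ≤ M) (j : ℕ) : deGiorgiLevel M j ∈ Icc M (2 * M) := by
  have h0 : (0 : ℝ) ≤ (1 / 2) ^ j := by positivity
  have h1 : (1 / 2 : ℝ) ^ j ≤ 1 := pow_le_one₀ (by norm_num) (by norm_num)
  constructor <;> unfold deGiorgiLevel <;> nlinarith

theorem deGiorgiLevel_succ_sub (M : ℝ) (j : ℕ) :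
    deGiorgiLevel M (j + 1) - deGiorgiLevel M j = M / (2 * 2 ^ j) := by
  simp only [deGiorgiLevel, one_div, inv_pow, pow_succ]
  field_simp
  ring

theorem rpow_deGiorgiLevel_succ_le {W : ℝ → ℝ} (hM : 0 < M) (hm₀ : m₀ ≤ M) (hq : 0 ≤ q)
    (hB : 0 ≤ B) (hW : ∀ m, 0 ≤ W m)
    (hrec : ∀ m h, m₀ ≤ m → m < h → (h - m) ^ r * W h ^ p ≤ B * h ^ q * W m ^ r) (j : ℕ) :
    W (deGiorgiLevel M (j + 1)) ^ p ≤
      B * 2 ^ (q + r) * M ^ (q - r) * (2 ^ r) ^ j * W (deGiorgiLevel M j) ^ r := by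
  have hgap := deGiorgiLevel_succ_sub M j
  have hgap_pos : 0 < M / (2 * 2 ^ j) := by positivity
  obtain ⟨hMj, -⟩ := deGiorgiLevel_mem_Icc hM.le j
  obtain ⟨hMj', hj'M⟩ := deGiorgiLevel_mem_Icc hM.le (j + 1)
  have hstep := hrec _ _ (hm₀.trans hMj) (sub_pos.1 (hgap ▸ hgap_pos))
  rw [hgap, Real.div_rpow hM.le (by positivity), Real.mul_rpow (by positivity) (by positivity),
    ← Real.rpow_pow_comm (by positivity), div_mul_eq_mul_div, div_le_iff₀ (by positivity)] at hstep
  have hlevel : deGiorgiLevel M (j + 1) ^ q ≤ 2 ^ q * M ^ q := by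
    rw [← Real.mul_rpow zero_le_two hM.le]
    exact Real.rpow_le_rpow (hM.le.trans hMj') hj'M hq
  have hWr := Real.rpow_nonneg (hW (deGiorgiLevel M j)) r
  rw [Real.rpow_sub hM, Real.rpow_add two_pos]
  calc W (deGiorgiLevel M (j + 1)) ^ p
      = (M ^ r * W (deGiorgiLevel M (j + 1)) ^ p) / M ^ r := by field_simp
    _ ≤ (B * (2 ^ q * M ^ q) * W (deGiorgiLevel M j) ^ r * (2 ^ r * (2 ^ r) ^ j)) / M ^ r := by
      refine div_le_div_of_nonneg_right (hstep.trans ?_) (by positivity)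
      gcongr
    _ = _ := by ring

/-- **De Giorgi iteration**: along the levels `M (2 - 2⁻ʲ)` the recursion forces geometric decay as
soon as `M` is large, because `q < r` makes its constant `B 2 ^ (q + r) M ^ (q - r)` small. -/
theorem exists_eq_zero_of_deGiorgi_recursion (hp : 0 < p) (hpr : p < r) (hq : 0 ≤ q) (hqr : q < r)
    (hB : 0 ≤ B) (hK : 0 ≤ K) (m₀ : ℝ) :
    ∃ C : ℝ, 0 < C ∧ m₀ ≤ C ∧ ∀ W : ℝ → ℝ,
      (∀ m, 0 ≤ W m) → AntitoneOn W (Ici m₀) → W m₀ ≤ K →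
      (∀ m h, m₀ ≤ m → m < h → (h - m) ^ r * W h ^ p ≤ B * h ^ q * W m ^ r) → W C = 0 := by
  have hrp : 0 < r - p := sub_pos.2 hpr
  obtain ⟨l, hl0, hl1, hl⟩ : ∃ l : ℝ, 0 < l ∧ l < 1 ∧ 2 ^ r * l ^ (r - p) = 1 := by
    refine ⟨2 ^ (-(r / (r - p))), by positivity, Real.rpow_lt_one_of_one_lt_of_neg one_lt_two
      (neg_lt_zero.2 (div_pos (hp.trans hpr) hrp)), ?_⟩
    rw [← Real.rpow_mul zero_le_two, ← Real.rpow_add two_pos, neg_mul, div_mul_cancel₀ _ hrp.ne',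
      add_neg_cancel, Real.rpow_zero]
  have hsmall : Tendsto (fun M : ℝ ↦ B * 2 ^ (q + r) * M ^ (q - r) * K ^ (r - p)) atTop (𝓝 0) := by
    simpa using ((tendsto_rpow_neg_atTop (sub_pos.2 hqr)).const_mul
      (B * 2 ^ (q + r))).mul_const (K ^ (r - p))
  obtain ⟨M, hMsmall, hM, hm₀⟩ := ((hsmall.eventually_le_const (Real.rpow_pos_of_pos hl0 p)).and
    ((eventually_gt_atTop 0).and (eventually_ge_atTop m₀))).exists
  refine ⟨2 * M, by positivity, by linarith, fun W hW hanti hWK hrec ↦ le_antisymm ?_ (hW _)⟩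
  have hlevel := deGiorgiLevel_mem_Icc hM.le
  have hdecay : ∀ j, W (deGiorgiLevel M j) ≤ K * l ^ j :=
    le_geometric_of_rpow_le hp hpr.le (by positivity) (by positivity) hK hl0.le hl.le hMsmall
      (fun j ↦ hW _) ((hanti self_mem_Ici (hm₀.trans (hlevel 0).1)
        (hm₀.trans (hlevel 0).1)).trans hWK)
      (rpow_deGiorgiLevel_succ_le hM hm₀ hq hB hW hrec)
  have hlim : Tendsto (fun j : ℕ ↦ K * l ^ j) atTop (𝓝 0) := by
    simpa using (tendsto_pow_atTop_nhds_zero_of_lt_one hl0.le hl1).const_mul K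
  have hm₀j (j : ℕ) : m₀ ≤ deGiorgiLevel M j := hm₀.trans (hlevel j).1
  exact ge_of_tendsto' hlim fun j ↦
    (hanti (hm₀j j) ((hm₀j j).trans (hlevel j).2) (hlevel j).2).trans (hdecay j)

theorem exists_eq_zero_of_deGiorgi_recursion_ennreal (hp : 0 < p) (hpr : p < r) (hq : 0 ≤ q)
    (hqr : q < r) {B K : ℝ≥0∞} (hB : B ≠ ⊤) (hK : K ≠ ⊤) (hm₀ : 0 ≤ m₀) :
    ∃ C : ℝ, 0 < C ∧ ∀ W : ℝ → ℝ≥0∞, Antitone W → W m₀ ≤ K →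
      (∀ m h, m₀ ≤ m → m < h →
        ENNReal.ofReal (h - m) ^ r * W h ^ p ≤ B * ENNReal.ofReal (h ^ q) * W m ^ r) →
      W C = 0 := by
  have hr : 0 ≤ r := hq.trans hqr.le
  obtain ⟨C, hC, hm₀C, hzero⟩ := exists_eq_zero_of_deGiorgi_recursion hp hpr hq hqr
    (ENNReal.toReal_nonneg (a := B)) (ENNReal.toReal_nonneg (a := K)) m₀
  refine ⟨C, hC, fun W hanti hWK hrec ↦ ?_⟩
  have hfin {m : ℝ} (hm : m₀ ≤ m) : W m ≠ ⊤ := ne_top_of_le_ne_top hK ((hanti hm).trans hWK)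
  refine ((ENNReal.toReal_eq_zero_iff _).1 (hzero (fun m ↦ (W m).toReal)
    (fun m ↦ ENNReal.toReal_nonneg) (fun m hm h _ hmh ↦ ENNReal.toReal_mono (hfin hm) (hanti hmh))
    (ENNReal.toReal_mono hK hWK) fun m h hm hmh ↦ ?_)).resolve_right (hfin hm₀C)
  have hh : 0 ≤ h := hm₀.trans (hm.trans hmh.le)
  have hreal := ENNReal.toReal_mono (ENNReal.mul_ne_top (ENNReal.mul_ne_top hB
    ENNReal.ofReal_ne_top) (ENNReal.rpow_ne_top_of_nonneg hr (hfin hm))) (hrec m h hm hmh)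
  simpa only [ENNReal.toReal_mul, ← ENNReal.toReal_rpow,
    ENNReal.toReal_ofReal (sub_nonneg.2 hmh.le), ENNReal.toReal_ofReal (Real.rpow_nonneg hh q)]
    using hreal

end DeGiorgi

/-! ### Truncations in `L^p` spaces -/

section Measure

variable {α E : Type*} [MeasurableSpace α] {μ : Measure α}

theorem eLpNorm_le_eLpNorm_mul_measure_support_rpow [NormedAddCommGroup E] {f : α → E}
    {s p : ℝ≥0∞} (hsp : s ≤ p) (hf : AEStronglyMeasurable f μ) {A : Set α} (hA : f.support ⊆ A) :
    eLpNorm f s μ ≤ eLpNorm f p μ * μ A ^ (1 / s.toReal - 1 / p.toReal) := by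
  have h := eLpNorm_le_eLpNorm_mul_rpow_measure_univ hsp (hf.restrict (s := A))
  rwa [eLpNorm_restrict_eq_of_support_subset hA, eLpNorm_restrict_eq_of_support_subset hA,
    Measure.restrict_apply_univ] at h

theorem eLpNorm_smul_le_eLpNorm_restrict_mul_rpow [NormedAddCommGroup E] [NormedSpace ℝ E]
    {c : α → ℝ} {g : α → E} {s p : ℝ≥0∞} (hsp : s ≤ p) (hg : AEStronglyMeasurable g μ)
    (hc1 : ∀ x, |c x| ≤ 1) {A : Set α} (hA : c.support ⊆ A) :
    eLpNorm (c • g) s μ ≤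
      eLpNorm g p (μ.restrict A) * μ A ^ (1 / s.toReal - 1 / p.toReal) := by
  rw [← eLpNorm_restrict_eq_of_support_subset ((Function.support_smul_subset_left _ _).trans hA),
    ← Measure.restrict_apply_univ A]
  refine (eLpNorm_mono fun x ↦ ?_).trans (eLpNorm_le_eLpNorm_mul_rpow_measure_univ hsp hg.restrict)
  rw [Pi.smul_apply', norm_smul]
  exact mul_le_of_le_one_left (norm_nonneg _) (hc1 x)

theorem tendsto_eLpNorm_zero_of_measure_support_le [NormedAddCommGroup E] {ι : Type*}
    {l : Filter ι} {f : ι → α → E} {s p : ℝ≥0∞} (hs : s ≠ 0) (hsp : s ≤ p) (hp : p ≠ ⊤)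
    (hf : ∀ i, AEStronglyMeasurable (f i) μ)
    (hlim : Tendsto (fun i ↦ eLpNorm (f i) p μ) l (𝓝 0)) {V : ℝ≥0∞} (hV : V ≠ ⊤)
    (hsupp : ∀ᶠ i in l, μ (f i).support ≤ V) :
    Tendsto (fun i ↦ eLpNorm (f i) s μ) l (𝓝 0) := by
  have hexp : 0 ≤ 1 / s.toReal - 1 / p.toReal :=
    sub_nonneg.2 (one_div_le_one_div_of_le
      (ENNReal.toReal_pos hs (ne_top_of_le_ne_top hp hsp)) (ENNReal.toReal_mono hp hsp))
  have hmul : Tendsto (fun i ↦ eLpNorm (f i) p μ * V ^ (1 / s.toReal - 1 / p.toReal)) l (𝓝 0) := by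
    simpa using ENNReal.Tendsto.mul_const hlim (.inr (ENNReal.rpow_ne_top_of_nonneg hexp hV))
  refine tendsto_of_tendsto_of_tendsto_of_le_of_le' tendsto_const_nhds hmul
    (Eventually.of_forall fun _ ↦ zero_le) (hsupp.mono fun i hi ↦ ?_)
  exact (eLpNorm_le_eLpNorm_mul_measure_support_rpow hsp (hf i) subset_rfl).trans (by gcongr)

theorem tendsto_eLpNorm_smul_sub_smul_const [NormedAddCommGroup E] [NormedSpace ℝ E] {p : ℝ≥0∞}
    (hp0 : p ≠ 0) (hp : p ≠ ⊤) {c : ℕ → α → ℝ} {c₀ : α → ℝ} {g : α → E}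
    (hc : ∀ n, AEStronglyMeasurable (c n) μ) (hc1 : ∀ n x, |c n x| ≤ 1)
    (hclim : ∀ᵐ x ∂μ, Tendsto (c · x) atTop (𝓝 (c₀ x))) (hg : MemLp g p μ) :
    Tendsto (fun n ↦ eLpNorm (c n • g - c₀ • g) p μ) atTop (𝓝 0) := by
  have hc₀ : AEStronglyMeasurable c₀ μ := aestronglyMeasurable_of_tendsto_ae atTop hc hclim
  have hp_pos : 0 < p.toReal := ENNReal.toReal_pos hp0 hp
  have hbound (n : ℕ) : ∀ᵐ x ∂μ, ‖(c n • g - c₀ • g) x‖ₑ ^ p.toReal ≤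
      ‖((2 : ℝ) • g) x‖ₑ ^ p.toReal := by
    filter_upwards [hclim] with x hx
    have hc₀1 : |c₀ x| ≤ 1 := le_of_tendsto' hx.abs fun n ↦ hc1 n x
    gcongr
    simp only [Pi.sub_apply, Pi.smul_apply', Pi.smul_apply, ← sub_smul, enorm_smul]
    gcongr
    rw [Real.enorm_eq_ofReal_abs, Real.enorm_eq_ofReal_abs, abs_two]
    exact ENNReal.ofReal_le_ofReal ((abs_sub _ _).trans (by linarith [hc1 n x]))
  have hfin : ∫⁻ x, ‖((2 : ℝ) • g) x‖ₑ ^ p.toReal ∂μ ≠ ⊤ :=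
    (lintegral_rpow_enorm_lt_top_of_eLpNorm_lt_top hp0 hp (hg.const_smul (2 : ℝ)).2).ne
  have hpt : ∀ᵐ x ∂μ, Tendsto (fun n ↦ ‖(c n • g - c₀ • g) x‖ₑ ^ p.toReal) atTop (𝓝 0) := by
    filter_upwards [hclim] with x hx
    have hsub : Tendsto (fun n ↦ c n x • g x - c₀ x • g x) atTop (𝓝 0) :=
      sub_self (c₀ x • g x) ▸ (hx.smul_const (g x)).sub_const _
    simpa [ENNReal.zero_rpow_of_pos hp_pos] using hsub.enorm.ennrpow_const p.toReal
  have hlim := tendsto_lintegral_of_dominated_convergence' _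
    (fun n ↦ ((((hc n).smul hg.1).sub (hc₀.smul hg.1)).enorm.pow_const _)) hbound hfin hpt
  simp only [eLpNorm_eq_lintegral_rpow_enorm_toReal hp0 hp]
  simpa [hp_pos] using hlim.ennrpow_const (1 / p.toReal)

theorem tendsto_eLpNorm_smul_sub_smul [NormedAddCommGroup E] [NormedSpace ℝ E] {p : ℝ≥0∞}
    (hp1 : 1 ≤ p) (hp : p ≠ ⊤) {c : ℕ → α → ℝ} {c₀ : α → ℝ} {G : ℕ → α → E} {g : α → E}
    (hc : ∀ n, AEStronglyMeasurable (c n) μ) (hc1 : ∀ n x, |c n x| ≤ 1)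
    (hclim : ∀ᵐ x ∂μ, Tendsto (c · x) atTop (𝓝 (c₀ x)))
    (hG : ∀ n, AEStronglyMeasurable (G n) μ) (hg : MemLp g p μ)
    (hGlim : Tendsto (fun n ↦ eLpNorm (G n - g) p μ) atTop (𝓝 0)) :
    Tendsto (fun n ↦ eLpNorm (c n • G n - c₀ • g) p μ) atTop (𝓝 0) := by
  have hc₀ : AEStronglyMeasurable c₀ μ := aestronglyMeasurable_of_tendsto_ae atTop hc hclim
  have hcoeff := tendsto_eLpNorm_smul_sub_smul_const (zero_lt_one.trans_le hp1).ne' hp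
    hc hc1 hclim hg
  have hsum : Tendsto (fun n ↦ eLpNorm (G n - g) p μ + eLpNorm (c n • g - c₀ • g) p μ) atTop
      (𝓝 0) := by simpa using hGlim.add hcoeff
  refine tendsto_of_tendsto_of_tendsto_of_le_of_le tendsto_const_nhds hsum (fun _ ↦ zero_le)
    fun n ↦ ?_
  have hsplit : c n • G n - c₀ • g = c n • (G n - g) + (c n • g - c₀ • g) := by
    rw [smul_sub, sub_add_sub_cancel]
  dsimp only
  rw [hsplit]
  refine (eLpNorm_add_le ((hc n).smul ((hG n).sub hg.1))
    (((hc n).smul hg.1).sub (hc₀.smul hg.1)) hp1).trans ?_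
  gcongr
  refine eLpNorm_mono fun x ↦ ?_
  rw [Pi.smul_apply', norm_smul]
  exact mul_le_of_le_one_left (norm_nonneg _) (hc1 n x)

theorem measure_setOf_lt_lt_top {f : α → ℝ} {p : ℝ≥0∞} (hp0 : p ≠ 0) (hp : p ≠ ⊤)
    (hf : MemLp f p μ) {m : ℝ} (hm : 0 < m) : μ {x | m < f x} < ⊤ := by
  refine (measure_mono fun x hx ↦ ?_).trans_lt
    (hf.meas_ge_lt_top'_enorm (ε := ENNReal.ofReal m) hp0 hp (by simpa using hm) (by simp))
  rw [mem_ofPred_eq, Real.enorm_eq_ofReal_abs]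
  exact ENNReal.ofReal_le_ofReal ((le_of_lt hx).trans (le_abs_self _))

theorem eventually_measure_setOf_lt_union_le {ι : Type*} {l : Filter ι} {f : ι → α → ℝ}
    {u : α → ℝ} (hfu : TendstoInMeasure μ f l u) {k m : ℝ} (hkm : k < m) :
    ∀ᶠ i in l, μ ({x | m < f i x} ∪ {x | m < u x}) ≤ μ {x | k < u x} + 1 := by
  have hgap : 0 < ENNReal.ofReal (m - k) := ENNReal.ofReal_pos.2 (sub_pos.2 hkm)
  filter_upwards [(hfu _ hgap).eventually_le_const one_pos] with i hi
  refine (measure_mono ?_).trans ((measure_union_le _ _).trans (by gcongr))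
  rintro x (hx | hx)
  · refine (lt_or_ge k (u x)).imp id fun hku ↦ ?_
    rw [mem_ofPred_eq] at hx
    rw [mem_ofPred_eq, edist_dist, Real.dist_eq]
    exact ENNReal.ofReal_le_ofReal ((by linarith : m - k ≤ f i x - u x).trans (le_abs_self _))
  · exact .inl (hkm.trans hx)

theorem eLpNorm_le_mul_eLpNorm_of_tendsto [NormedAddCommGroup E] {F : Type*}
    [NormedAddCommGroup F] {r s : ℝ≥0∞} (hs : 1 ≤ s) {C : ℝ≥0} {w : ℕ → α → F} {w₀ : α → F}
    {v : ℕ → α → E} {v₀ : α → E} (hw : ∀ n, AEStronglyMeasurable (w n) μ)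
    (hwlim : ∀ᵐ x ∂μ, Tendsto (w · x) atTop (𝓝 (w₀ x)))
    (hv : ∀ n, AEStronglyMeasurable (v n) μ) (hv₀ : AEStronglyMeasurable v₀ μ)
    (hvlim : Tendsto (fun n ↦ eLpNorm (v n - v₀) s μ) atTop (𝓝 0))
    (hle : ∀ n, eLpNorm (w n) r μ ≤ C * eLpNorm (v n) s μ) :
    eLpNorm w₀ r μ ≤ C * eLpNorm v₀ s μ := by
  have hlim : Tendsto (fun n ↦ C * (eLpNorm (v n - v₀) s μ + eLpNorm v₀ s μ)) atTop
      (𝓝 (C * eLpNorm v₀ s μ)) := by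
    simpa using ENNReal.Tendsto.const_mul (hvlim.add_const _) (.inr ENNReal.coe_ne_top)
  refine (Lp.eLpNorm_lim_le_liminf_eLpNorm hw w₀ hwlim).trans
    ((liminf_le_liminf (.of_forall fun n ↦ (hle n).trans ?_)).trans hlim.liminf_eq.le)
  gcongr
  simpa using eLpNorm_add_le ((hv n).sub hv₀) hv₀ hs

theorem antitone_eLpNorm_truncation (μ : Measure α) (u : α → ℝ) (r : ℝ≥0∞) :
    Antitone fun m : ℝ ↦ eLpNorm (fun x ↦ max (u x - m) 0) r μ := by
  refine fun m h hmh ↦ eLpNorm_mono_real fun x ↦ ?_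
  rw [Real.norm_of_nonneg (le_max_right _ _)]
  gcongr

theorem ae_le_of_eLpNorm_truncation_eq_zero {u : α → ℝ} (hu : AEStronglyMeasurable u μ)
    {r : ℝ≥0∞} (hr : r ≠ 0) {m : ℝ} (hzero : eLpNorm (fun x ↦ max (u x - m) 0) r μ = 0) :
    ∀ᵐ x ∂μ, u x ≤ m := by
  have hmeas : AEStronglyMeasurable (fun x ↦ max (u x - m) 0) μ :=
    (hu.sub aestronglyMeasurable_const).sup aestronglyMeasurable_const
  filter_upwards [(eLpNorm_eq_zero_iff hmeas hr).1 hzero] with x hx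
  exact sub_nonpos.1 (max_eq_right_iff.1 hx)

end Measure

theorem sub_rpow_mul_rpow_le_rpow_mul_sub_rpow {m h t q r : ℝ} (hm : 0 ≤ m) (hmh : m < h)
    (hht : h ≤ t) (hq : 0 ≤ q) (hqr : q ≤ r) :
    (h - m) ^ r * t ^ q ≤ h ^ q * (t - m) ^ r := by
  have hd : 0 < h - m := sub_pos.2 hmh
  have hdt : h - m ≤ t - m := sub_le_sub_right hht m
  have hd' : 0 ≤ t - m := hd.le.trans hdt
  have hcross : (h - m) * t ≤ h * (t - m) := by nlinarith
  calc (h - m) ^ r * t ^ q = (h - m) ^ (r - q) * ((h - m) * t) ^ q := by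
        rw [Real.mul_rpow hd.le (by linarith), ← mul_assoc, ← Real.rpow_add hd, sub_add_cancel]
    _ ≤ (t - m) ^ (r - q) * (h * (t - m)) ^ q := by
        have : 0 ≤ (h - m) * t := mul_nonneg hd.le (by linarith)
        gcongr
    _ = h ^ q * (t - m) ^ r := by
        rw [Real.mul_rpow (by linarith) hd', mul_left_comm,
          ← Real.rpow_add (hd.trans_le hdt), sub_add_cancel]

theorem ofReal_sub_rpow_mul_add_enorm_rpow_le {m h t q r : ℝ} (hm : 0 ≤ m) (hmh : m < h)
    (hht : h ≤ t) (hq : 0 ≤ q) (hqr : q ≤ r) :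
    ENNReal.ofReal (h - m) ^ r * (ENNReal.ofReal (h ^ q) + ‖t‖ₑ ^ q) ≤
      2 * ENNReal.ofReal (h ^ q) * ‖max (t - m) 0‖ₑ ^ r := by
  have hr : 0 ≤ r := hq.trans hqr
  have hhm : 0 ≤ h - m := sub_nonneg.2 hmh.le
  have hh : 0 ≤ h := hm.trans hmh.le
  have ht : 0 ≤ t := hh.trans hht
  have htm : 0 ≤ t - m := sub_nonneg.2 (hmh.le.trans hht)
  rw [max_eq_left htm, Real.enorm_of_nonneg ht, Real.enorm_of_nonneg htm,
    ENNReal.ofReal_rpow_of_nonneg hhm hr, ENNReal.ofReal_rpow_of_nonneg ht hq,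
    ENNReal.ofReal_rpow_of_nonneg htm hr, mul_assoc, ← ENNReal.ofReal_mul (by positivity),
    mul_add, two_mul, ← ENNReal.ofReal_mul (by positivity), ← ENNReal.ofReal_mul (by positivity)]
  refine add_le_add (ENNReal.ofReal_le_ofReal ?_) (ENNReal.ofReal_le_ofReal
    (sub_rpow_mul_rpow_le_rpow_mul_sub_rpow hm hmh hht hq hqr))
  rw [mul_comm]
  gcongr

theorem ofReal_sub_rpow_mul_superlevel_lintegral_le {α : Type*} [MeasurableSpace α]
    {μ : Measure α} {u : α → ℝ} (hu : AEStronglyMeasurable u μ) {m h q r : ℝ} (hm : 0 ≤ m)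
    (hmh : m < h) (hq : 0 ≤ q) (hqr : q ≤ r) :
    ENNReal.ofReal (h - m) ^ r * (ENNReal.ofReal (h ^ q) * μ {x | h < u x} +
        ∫⁻ x in {x | h < u x}, ‖u x‖ₑ ^ q ∂μ) ≤
      2 * ENNReal.ofReal (h ^ q) * ∫⁻ x, ‖max (u x - m) 0‖ₑ ^ r ∂μ := by
  have hnull : NullMeasurableSet {x | h < u x} μ :=
    nullMeasurableSet_lt aemeasurable_const hu.aemeasurable
  calc _ = ∫⁻ x in {x | h < u x},
          ENNReal.ofReal (h - m) ^ r * (ENNReal.ofReal (h ^ q) + ‖u x‖ₑ ^ q) ∂μ := by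
        rw [lintegral_const_mul' _ _
            (ENNReal.rpow_ne_top_of_nonneg (hq.trans hqr) ENNReal.ofReal_ne_top),
          lintegral_add_left measurable_const, setLIntegral_const]
    _ ≤ ∫⁻ x in {x | h < u x}, 2 * ENNReal.ofReal (h ^ q) * ‖max (u x - m) 0‖ₑ ^ r ∂μ := by
        refine lintegral_mono_ae ?_
        filter_upwards [ae_restrict_mem₀ hnull] with x hx using
          ofReal_sub_rpow_mul_add_enorm_rpow_le hm hmh (le_of_lt hx) hq hqr
    _ ≤ ∫⁻ x, 2 * ENNReal.ofReal (h ^ q) * ‖max (u x - m) 0‖ₑ ^ r ∂μ :=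
        setLIntegral_le_lintegral _ _
    _ = _ := lintegral_const_mul' _ _ (by finiteness)

/-! ### The Sobolev inequality for truncations -/

theorem norm_gradient {E : Type*} [NormedAddCommGroup E] [InnerProductSpace ℝ E]
    [CompleteSpace E] (f : E → ℝ) (x : E) : ‖gradient f x‖ = ‖fderiv ℝ f x‖ := by
  simp [gradient]

theorem norm_fderiv_comp {E : Type*} [NormedAddCommGroup E] [InnerProductSpace ℝ E]
    [CompleteSpace E] {F : ℝ → ℝ} {f : E → ℝ} {x : E} (hF : DifferentiableAt ℝ F (f x))
    (hf : DifferentiableAt ℝ f x) :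
    ‖fderiv ℝ (F ∘ f) x‖ = ‖deriv F (f x) • gradient f x‖ := by
  rw [(hF.hasDerivAt.comp_hasFDerivAt x hf.hasFDerivAt).fderiv, norm_smul, norm_smul,
    norm_gradient]

theorem superlevel_eq_inter {N : ℕ} (Ω : Set (EuclideanSpace ℝ (Fin N)))
    (u : EuclideanSpace ℝ (Fin N) → ℝ) (m : ℝ) : superlevel Ω u m = {x | m < u x} ∩ Ω := by
  rw [inter_comm]; rfl

section Sobolev

variable {N : ℕ} {Ω : Set (EuclideanSpace ℝ (Fin N))} {p : ℝ}
  {u φ : EuclideanSpace ℝ (Fin N) → ℝ} {g : EuclideanSpace ℝ (Fin N) → EuclideanSpace ℝ (Fin N)}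

theorem IsTestFunction.continuous_gradient (hφ : IsTestFunction Ω φ) : Continuous (gradient φ) :=
  (InnerProductSpace.toDual ℝ _).symm.continuous.comp (hφ.smooth.continuous_fderiv (by simp))

theorem IsTestFunction.support_gradient_subset (hφ : IsTestFunction Ω φ) :
    (gradient φ).support ⊆ Ω := by
  refine fun x hx ↦ hφ.support_subset (support_fderiv_subset ℝ ?_)
  rwa [Function.mem_support, ← norm_ne_zero_iff, norm_gradient, norm_ne_zero_iff] at hx

theorem IsTestFunction.eLpNorm_comp_le (hφ : IsTestFunction Ω φ) (hN : 0 < N) {s r : ℝ≥0}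
    (hs : 1 ≤ s) (hsr : (r : ℝ)⁻¹ = (s : ℝ)⁻¹ - (N : ℝ)⁻¹) {F : ℝ → ℝ} (hF : ContDiff ℝ 1 F)
    (hF0 : F 0 = 0) :
    eLpNorm (F ∘ φ) r (volume.restrict Ω) ≤
      SNormLESNormFDerivOfEqConst ℝ (volume : Measure (EuclideanSpace ℝ (Fin N))) s *
        eLpNorm ((deriv F ∘ φ) • gradient φ) s (volume.restrict Ω) := by
  rw [eLpNorm_restrict_eq_of_support_subset ((Function.support_smul_subset_right _ _).trans
    hφ.support_gradient_subset)]
  have hcomp : ContDiff ℝ 1 (F ∘ φ) := hF.comp (hφ.smooth.of_le (by simp))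
  calc eLpNorm (F ∘ φ) r (volume.restrict Ω) ≤ eLpNorm (F ∘ φ) r volume :=
        eLpNorm_mono_measure _ Measure.restrict_le_self
    _ ≤ _ := eLpNorm_le_eLpNorm_fderiv_of_eq volume hcomp (hφ.compact_support.comp_left hF0) hs
        (by simpa using hN) (by simpa using hsr)
    _ = _ := by
        congr 1
        exact eLpNorm_congr_norm_ae (.of_forall fun x ↦ norm_fderiv_comp
          (hF.differentiable one_ne_zero _) (hφ.smooth.differentiable (by simp) x))

theorem eLpNorm_le_sobolevNorm (Ω : Set (EuclideanSpace ℝ (Fin N))) (hp : 0 < p)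
    (u : EuclideanSpace ℝ (Fin N) → ℝ)
    (g : EuclideanSpace ℝ (Fin N) → EuclideanSpace ℝ (Fin N)) :
    eLpNorm u (ENNReal.ofReal p) (volume.restrict Ω) ≤ sobolevNorm Ω p u g ∧
      eLpNorm g (ENNReal.ofReal p) (volume.restrict Ω) ≤ sobolevNorm Ω p u g := by
  have hp0 : ENNReal.ofReal p ≠ 0 := by simpa using hp
  constructor <;> rw [eLpNorm_eq_lintegral_rpow_enorm_toReal hp0 ENNReal.ofReal_ne_top,
    ENNReal.toReal_ofReal hp.le, sobolevNorm]
  · exact ENNReal.rpow_le_rpow le_add_self (by positivity)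
  · exact ENNReal.rpow_le_rpow le_self_add (by positivity)

theorem MemW01p.exists_seq_tendsto (hp : 0 < p) (h : MemW01p Ω p u g) :
    ∃ φ : ℕ → EuclideanSpace ℝ (Fin N) → ℝ, (∀ n, IsTestFunction Ω (φ n)) ∧
      (∀ᵐ x ∂volume.restrict Ω, Tendsto (φ · x) atTop (𝓝 (u x))) ∧
      Tendsto (fun n ↦ eLpNorm (φ n - u) (ENNReal.ofReal p) (volume.restrict Ω)) atTop (𝓝 0) ∧
      Tendsto (fun n ↦ eLpNorm (gradient (φ n) - g) (ENNReal.ofReal p) (volume.restrict Ω))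
        atTop (𝓝 0) := by
  choose φ hφ hφn using fun n : ℕ ↦ h.exists_approx ((n : ℝ≥0∞) + 1)⁻¹ (by simp)
  have hinv : Tendsto (fun n : ℕ ↦ ((n : ℝ≥0∞) + 1)⁻¹) atTop (𝓝 0) := by
    simpa using (tendsto_add_atTop_iff_nat 1).2 ENNReal.tendsto_inv_nat_nhds_zero
  have hu : Tendsto (fun n ↦ eLpNorm (φ n - u) (ENNReal.ofReal p) (volume.restrict Ω))
      atTop (𝓝 0) :=
    tendsto_of_tendsto_of_tendsto_of_le_of_le tendsto_const_nhds hinv (fun _ ↦ zero_le) fun n ↦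
      (eLpNorm_sub_comm _ _ _ _).trans_le ((eLpNorm_le_sobolevNorm Ω hp _ _).1.trans (hφn n).le)
  have hg : Tendsto (fun n ↦ eLpNorm (gradient (φ n) - g) (ENNReal.ofReal p) (volume.restrict Ω))
      atTop (𝓝 0) :=
    tendsto_of_tendsto_of_tendsto_of_le_of_le tendsto_const_nhds hinv (fun _ ↦ zero_le) fun n ↦
      (eLpNorm_sub_comm _ _ _ _).trans_le ((eLpNorm_le_sobolevNorm Ω hp _ _).2.trans (hφn n).le)
  obtain ⟨ns, hns, hae⟩ := (tendstoInMeasure_of_tendsto_eLpNorm (by simpa using hp)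
    (fun n ↦ (hφ n).smooth.continuous.aestronglyMeasurable) h.memW1p.memLp.1
    hu).exists_seq_tendsto_ae
  exact ⟨fun n ↦ φ (ns n), fun n ↦ hφ _, hae, hu.comp hns.tendsto_atTop,
    hg.comp hns.tendsto_atTop⟩

/-- On a domain of infinite measure `L^p` convergence does not give `L^s` convergence for `s < p`;
it does here because `deriv F` vanishes below the positive level `m`. -/
theorem MemW01p.exists_seq_tendsto_deriv_smul (h : MemW01p Ω p u g) {s : ℝ≥0} (hs : 1 ≤ s)
    (hsp : s ≤ p) {F : ℝ → ℝ} (hF : ContDiff ℝ 1 F) (hF1 : ∀ t, |deriv F t| ≤ 1) {m : ℝ}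
    (hm : 0 < m) (hFm : ∀ t ≤ m, deriv F t = 0) :
    ∃ φ : ℕ → EuclideanSpace ℝ (Fin N) → ℝ, (∀ n, IsTestFunction Ω (φ n)) ∧
      (∀ᵐ x ∂volume.restrict Ω, Tendsto (φ · x) atTop (𝓝 (u x))) ∧
      Tendsto (fun n ↦ eLpNorm ((deriv F ∘ φ n) • gradient (φ n) - (deriv F ∘ u) • g) s
        (volume.restrict Ω)) atTop (𝓝 0) := by
  have hs1 : 1 ≤ (s : ℝ≥0∞) := by exact_mod_cast hs
  have hsp' : (s : ℝ≥0∞) ≤ ENNReal.ofReal p := by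
    rw [← ENNReal.ofReal_coe_nnreal]; exact ENNReal.ofReal_le_ofReal hsp
  have hp1 : 1 ≤ ENNReal.ofReal p := hs1.trans hsp'
  have hp0 : ENNReal.ofReal p ≠ 0 := (zero_lt_one.trans_le hp1).ne'
  have hF' : Continuous (deriv F) := hF.continuous_deriv le_rfl
  obtain ⟨φ, hφ, hae, hφu, hφg⟩ := h.exists_seq_tendsto (ENNReal.ofReal_ne_zero_iff.1 hp0)
  have hφm (n : ℕ) : AEStronglyMeasurable (φ n) (volume.restrict Ω) :=
    (hφ n).smooth.continuous.aestronglyMeasurable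
  have hgm (n : ℕ) : AEStronglyMeasurable (gradient (φ n)) (volume.restrict Ω) :=
    (hφ n).continuous_gradient.aestronglyMeasurable
  have hlim := tendsto_eLpNorm_smul_sub_smul hp1 ENNReal.ofReal_ne_top
    (fun n ↦ hF'.comp_aestronglyMeasurable (hφm n)) (fun n x ↦ hF1 _)
    (hae.mono fun x hx ↦ (hF'.tendsto _).comp hx) hgm h.memW1p.memLp_grad hφg
  have hmeas : volume.restrict Ω {x | m / 2 < u x} + 1 ≠ ⊤ := ENNReal.add_ne_top.2
    ⟨(measure_setOf_lt_lt_top hp0 ENNReal.ofReal_ne_top h.memW1p.memLp (half_pos hm)).ne, by simp⟩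
  have hsupp (n : ℕ) : ((deriv F ∘ φ n) • gradient (φ n) - (deriv F ∘ u) • g).support ⊆
      {x | m < φ n x} ∪ {x | m < u x} := by
    intro x hx
    by_contra hxm
    simp only [mem_union, mem_ofPred_eq, not_or, not_lt] at hxm
    simp [hFm _ hxm.1, hFm _ hxm.2] at hx
  have hinmeas := tendstoInMeasure_of_tendsto_eLpNorm hp0 hφm h.memW1p.memLp.1 hφu
  exact ⟨φ, hφ, hae, tendsto_eLpNorm_zero_of_measure_support_le (zero_lt_one.trans_le hs1).ne' hsp'
    ENNReal.ofReal_ne_top (fun n ↦ ((hF'.comp_aestronglyMeasurable (hφm n)).smul (hgm n)).sub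
      ((hF'.comp_aestronglyMeasurable h.memW1p.memLp.1).smul h.memW1p.memLp_grad.1)) hlim hmeas
    ((eventually_measure_setOf_lt_union_le hinmeas (half_lt_self hm)).mono fun n hn ↦
      (measure_mono (hsupp n)).trans hn)⟩

theorem MemW01p.eLpNorm_comp_le (h : MemW01p Ω p u g) (hN : 0 < N) {s r : ℝ≥0} (hs : 1 ≤ s)
    (hsp : s ≤ p) (hsr : (r : ℝ)⁻¹ = (s : ℝ)⁻¹ - (N : ℝ)⁻¹) {F : ℝ → ℝ} (hF : ContDiff ℝ 1 F)
    (hF0 : F 0 = 0) (hF1 : ∀ t, |deriv F t| ≤ 1) {m : ℝ} (hm : 0 < m)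
    (hFm : ∀ t ≤ m, deriv F t = 0) :
    eLpNorm (F ∘ u) r (volume.restrict Ω) ≤
      SNormLESNormFDerivOfEqConst ℝ (volume : Measure (EuclideanSpace ℝ (Fin N))) s *
        eLpNorm ((deriv F ∘ u) • g) s (volume.restrict Ω) := by
  have hF' : Continuous (deriv F) := hF.continuous_deriv le_rfl
  obtain ⟨φ, hφ, hae, hlim⟩ := h.exists_seq_tendsto_deriv_smul hs hsp hF hF1 hm hFm
  have hφm (n : ℕ) : AEStronglyMeasurable (φ n) (volume.restrict Ω) :=
    (hφ n).smooth.continuous.aestronglyMeasurable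
  exact eLpNorm_le_mul_eLpNorm_of_tendsto (by exact_mod_cast hs)
    (fun n ↦ hF.continuous.comp_aestronglyMeasurable (hφm n))
    (hae.mono fun x hx ↦ (hF.continuous.tendsto _).comp hx)
    (fun n ↦ (hF'.comp_aestronglyMeasurable (hφm n)).smul
      (hφ n).continuous_gradient.aestronglyMeasurable)
    ((hF'.comp_aestronglyMeasurable h.memW1p.memLp.1).smul h.memW1p.memLp_grad.1) hlim
    fun n ↦ (hφ n).eLpNorm_comp_le hN hs hsr hF hF0

theorem MemW01p.eLpNorm_comp_le_superlevel (h : MemW01p Ω p u g) (hΩ : MeasurableSet Ω)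
    (hN : 0 < N) {s r : ℝ≥0} (hs : 1 ≤ s) (hsp : s ≤ p)
    (hsr : (r : ℝ)⁻¹ = (s : ℝ)⁻¹ - (N : ℝ)⁻¹) {F : ℝ → ℝ} (hF : ContDiff ℝ 1 F) (hF0 : F 0 = 0)
    (hF1 : ∀ t, |deriv F t| ≤ 1) {m : ℝ} (hm : 0 < m) (hFm : ∀ t ≤ m, deriv F t = 0) :
    eLpNorm (F ∘ u) r (volume.restrict Ω) ≤
      SNormLESNormFDerivOfEqConst ℝ (volume : Measure (EuclideanSpace ℝ (Fin N))) s *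
        (eLpNorm g (ENNReal.ofReal p) (volume.restrict (superlevel Ω u m)) *
          volume (superlevel Ω u m) ^ (1 / (s : ℝ) - 1 / p)) := by
  have hsp' : (s : ℝ≥0∞) ≤ ENNReal.ofReal p := by
    rw [← ENNReal.ofReal_coe_nnreal]; exact ENNReal.ofReal_le_ofReal hsp
  have hsupp : (deriv F ∘ u).support ⊆ {x | m < u x} := fun x hx ↦
    not_le.1 fun hxm ↦ hx (hFm _ hxm)
  have hholder := eLpNorm_smul_le_eLpNorm_restrict_mul_rpow hsp' h.memW1p.memLp_grad.1
    (fun x ↦ hF1 (u x)) hsupp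
  rw [Measure.restrict_restrict' hΩ, Measure.restrict_apply' hΩ, ← superlevel_eq_inter,
    ENNReal.coe_toReal, ENNReal.toReal_ofReal (s.coe_nonneg.trans hsp)] at hholder
  exact (h.eLpNorm_comp_le hN hs hsp hsr hF hF0 hF1 hm hFm).trans (mul_le_mul_right hholder _)

theorem MemW01p.eLpNorm_truncation_le (h : MemW01p Ω p u g) (hΩ : MeasurableSet Ω) (hN : 0 < N)
    {s r : ℝ≥0} (hs : 1 ≤ s) (hsp : s ≤ p) (hsr : (r : ℝ)⁻¹ = (s : ℝ)⁻¹ - (N : ℝ)⁻¹)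
    {m : ℝ} (hm : 0 < m) :
    eLpNorm (fun x ↦ max (u x - m) 0) r (volume.restrict Ω) ≤
      SNormLESNormFDerivOfEqConst ℝ (volume : Measure (EuclideanSpace ℝ (Fin N))) s *
        (eLpNorm g (ENNReal.ofReal p) (volume.restrict (superlevel Ω u m)) *
          volume (superlevel Ω u m) ^ (1 / (s : ℝ) - 1 / p)) := by
  let F (ε t : ℝ) : ℝ := smoothPosPart ε (t - m)
  have hF {ε : ℝ} (hε : 0 < ε) : ContDiff ℝ 1 (F ε) :=
    (contDiff_smoothPosPart hε).comp (contDiff_id.sub contDiff_const)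
  have hderiv (ε t : ℝ) : deriv (F ε) t = deriv (smoothPosPart ε) (t - m) :=
    deriv_comp_sub_const (smoothPosPart ε) m t
  have hε (n : ℕ) : 0 < 1 / ((n : ℝ) + 1) := by positivity
  refine (Lp.eLpNorm_lim_le_liminf_eLpNorm (f := fun n : ℕ ↦ F (1 / ((n : ℝ) + 1)) ∘ u)
    (fun n ↦ (hF (hε n)).continuous.comp_aestronglyMeasurable h.memW1p.memLp.1) _
    (.of_forall fun x ↦ ?_)).trans (liminf_le_of_frequently_le' (.of_forall fun n ↦ ?_))
  · exact (tendsto_smoothPosPart _).comp tendsto_one_div_add_atTop_nhds_zero_nat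
  · exact h.eLpNorm_comp_le_superlevel hΩ hN hs hsp hsr (hF (hε n))
      (smoothPosPart_of_nonpos (hε n) (by linarith))
      (fun t ↦ hderiv _ t ▸ abs_deriv_smoothPosPart_le_one (hε n) _) hm
      fun t ht ↦ hderiv _ t ▸ deriv_smoothPosPart_of_nonpos (hε n) (sub_nonpos.2 ht)

end Sobolev

/-! ### Energy estimates on superlevel sets -/

theorem exists_sobolev_exponents {N : ℕ} {p q : ℝ} (hN : 2 ≤ N) (hp : 1 ≤ p)
    (hq : (q : EReal) < sobolevExponent N p) :
    ∃ s r : ℝ≥0, 1 ≤ s ∧ (s : ℝ) ≤ p ∧ (r : ℝ)⁻¹ = (s : ℝ)⁻¹ - (N : ℝ)⁻¹ ∧ p < r ∧ q < r := by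
  have hN' : (2 : ℝ) ≤ N := by exact_mod_cast hN
  have hp0 : 0 < p := zero_lt_one.trans_le hp
  by_cases hpN : p < N
  · have hNp : 0 < N - p := sub_pos.2 hpN
    rw [sobolevExponent, if_pos hpN, EReal.coe_lt_coe_iff] at hq
    refine ⟨⟨p, hp0.le⟩, ⟨N * p / (N - p), by positivity⟩, hp, le_rfl, ?_, ?_, hq⟩
    · change (N * p / (N - p))⁻¹ = p⁻¹ - (N : ℝ)⁻¹
      field_simp
    · change p < N * p / (N - p)
      rw [lt_div_iff₀ hNp]
      nlinarith
  · obtain ⟨t, ht, hpt, hqt⟩ : ∃ t : ℝ, 2 ≤ t ∧ p < t ∧ q < t :=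
      ⟨max p q + 2, by linarith [le_max_left p q], by linarith [le_max_left p q],
        by linarith [le_max_right p q]⟩
    refine ⟨⟨N * t / (N + t), by positivity⟩, ⟨t, by positivity⟩, ?_, ?_, ?_, hpt, hqt⟩
    · change 1 ≤ N * t / (N + t)
      rw [le_div_iff₀ (by positivity)]
      nlinarith
    · change N * t / (N + t) ≤ p
      rw [div_le_iff₀ (by positivity)]
      nlinarith
    · change t⁻¹ = (N * t / (N + t))⁻¹ - (N : ℝ)⁻¹
      field_simp
      ring

section Energy

variable {N : ℕ} {Ω : Set (EuclideanSpace ℝ (Fin N))} {p q a : ℝ}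
  {u : EuclideanSpace ℝ (Fin N) → ℝ} {g : EuclideanSpace ℝ (Fin N) → EuclideanSpace ℝ (Fin N)}

theorem superlevel_anti (Ω : Set (EuclideanSpace ℝ (Fin N)))
    (u : EuclideanSpace ℝ (Fin N) → ℝ) : Antitone (superlevel Ω u) :=
  fun _ _ hmh _ hx ↦ ⟨hx.1, hmh.trans_lt hx.2⟩

theorem MemW01p.eLpNorm_truncation_le_of_volume_le (h : MemW01p Ω p u g) (hΩ : MeasurableSet Ω)
    (hN : 0 < N) {s r : ℝ≥0} (hs : 1 ≤ s) (hsp : s ≤ p)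
    (hsr : (r : ℝ)⁻¹ = (s : ℝ)⁻¹ - (N : ℝ)⁻¹) {m : ℝ} (hm : 0 < m) {v : ℝ≥0∞}
    (hv : volume (superlevel Ω u m) ≤ v) :
    eLpNorm (fun x ↦ max (u x - m) 0) r (volume.restrict Ω) ≤
      SNormLESNormFDerivOfEqConst ℝ (volume : Measure (EuclideanSpace ℝ (Fin N))) s *
        v ^ (1 / (s : ℝ) - 1 / p) *
          eLpNorm g (ENNReal.ofReal p) (volume.restrict (superlevel Ω u m)) := by
  have hexp : 0 ≤ 1 / (s : ℝ) - 1 / p :=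
    sub_nonneg.2 (one_div_le_one_div_of_le (zero_lt_one.trans_le hs) hsp)
  refine (h.eLpNorm_truncation_le hΩ hN hs hsp hsr hm).trans ?_
  rw [mul_assoc, mul_comm (v ^ _)]
  gcongr

theorem deGiorgi_recursion_of_energy_superlevel (hΩ : MeasurableSet Ω)
    (hu : AEStronglyMeasurable u (volume.restrict Ω)) (hp : 0 < p) (hq : 0 ≤ q) {r : ℝ≥0}
    (hqr : q < r) {D : ℝ≥0∞} {m h : ℝ} (hm : 0 ≤ m) (hmh : m < h)
    (hsob : eLpNorm (fun x ↦ max (u x - h) 0) r (volume.restrict Ω) ≤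
      D * eLpNorm g (ENNReal.ofReal p) (volume.restrict (superlevel Ω u h)))
    (henergy : ∫⁻ x in superlevel Ω u h, ‖g x‖ₑ ^ p ≤
      ENNReal.ofReal a * (ENNReal.ofReal (h ^ q) * volume (superlevel Ω u h) +
        ∫⁻ x in superlevel Ω u h, ‖u x‖ₑ ^ q)) :
    ENNReal.ofReal (h - m) ^ (r : ℝ) *
        eLpNorm (fun x ↦ max (u x - h) 0) r (volume.restrict Ω) ^ p ≤
      D ^ p * ENNReal.ofReal a * 2 * ENNReal.ofReal (h ^ q) *
        eLpNorm (fun x ↦ max (u x - m) 0) r (volume.restrict Ω) ^ (r : ℝ) := by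
  have hr : r ≠ 0 := by exact_mod_cast (hq.trans_lt hqr).ne'
  have hgrad : eLpNorm g (ENNReal.ofReal p) (volume.restrict (superlevel Ω u h)) ^ p =
      ∫⁻ x in superlevel Ω u h, ‖g x‖ₑ ^ p := by
    simpa only [ENNReal.ofReal, Real.coe_toNNReal p hp.le] using
      eLpNorm_nnreal_pow_eq_lintegral (Real.toNNReal_pos.2 hp).ne'
  have hlevel := ofReal_sub_rpow_mul_superlevel_lintegral_le hu hm hmh hq hqr.le
  rw [Measure.restrict_restrict' hΩ, Measure.restrict_apply' hΩ, ← superlevel_eq_inter,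
    ← eLpNorm_nnreal_pow_eq_lintegral hr] at hlevel
  calc _ ≤ ENNReal.ofReal (h - m) ^ (r : ℝ) *
        (D * eLpNorm g (ENNReal.ofReal p) (volume.restrict (superlevel Ω u h))) ^ p := by gcongr
    _ = ENNReal.ofReal (h - m) ^ (r : ℝ) *
          (D ^ p * ∫⁻ x in superlevel Ω u h, ‖g x‖ₑ ^ p) := by
        rw [ENNReal.mul_rpow_of_nonneg _ _ hp.le, hgrad]
    _ ≤ ENNReal.ofReal (h - m) ^ (r : ℝ) * (D ^ p * (ENNReal.ofReal a *
          (ENNReal.ofReal (h ^ q) * volume (superlevel Ω u h) +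
            ∫⁻ x in superlevel Ω u h, ‖u x‖ₑ ^ q))) := by gcongr
    _ = D ^ p * ENNReal.ofReal a * (ENNReal.ofReal (h - m) ^ (r : ℝ) *
          (ENNReal.ofReal (h ^ q) * volume (superlevel Ω u h) +
            ∫⁻ x in superlevel Ω u h, ‖u x‖ₑ ^ q)) := by ring
    _ ≤ D ^ p * ENNReal.ofReal a * (2 * ENNReal.ofReal (h ^ q) *
          eLpNorm (fun x ↦ max (u x - m) 0) r (volume.restrict Ω) ^ (r : ℝ)) := by gcongr
    _ = _ := by ring

end Energy

theorem exists_ae_le_of_energy_superlevel {N : ℕ} {p q : ℝ} (hN : 2 ≤ N) (hp : 1 ≤ p) (hq : 0 ≤ q)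
    (hq' : (q : EReal) < sobolevExponent N p) (a a₀ m₀ : ℝ) :
    ∃ C : ℝ, 0 < C ∧
      ∀ (Ω : Set (EuclideanSpace ℝ (Fin N))), MeasurableSet Ω →
      ∀ (u : EuclideanSpace ℝ (Fin N) → ℝ)
        (g : EuclideanSpace ℝ (Fin N) → EuclideanSpace ℝ (Fin N)), MemW01p Ω p u g →
        (∀ m : ℝ, m₀ ≤ m →
            ∫⁻ x in superlevel Ω u m, ‖g x‖ₑ ^ p ≤
              ENNReal.ofReal a * (ENNReal.ofReal (m ^ q) * volume (superlevel Ω u m) +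
                ∫⁻ x in superlevel Ω u m, ‖u x‖ₑ ^ q)) →
          max (volume (superlevel Ω u m₀)) (sobolevNorm Ω p u g) ≤ ENNReal.ofReal a₀ →
          ∀ᵐ x ∂volume.restrict Ω, u x ≤ C := by
  have hp0 : 0 < p := zero_lt_one.trans_le hp
  obtain ⟨s, r, hs, hsp, hsr, hpr, hqr⟩ := exists_sobolev_exponents hN hp hq'
  have hr0 : (r : ℝ≥0∞) ≠ 0 := by exact_mod_cast (hq.trans_lt hqr).ne'
  have hexp : 0 ≤ 1 / (s : ℝ) - 1 / p :=
    sub_nonneg.2 (one_div_le_one_div_of_le (zero_lt_one.trans_le hs) hsp)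
  let D : ℝ≥0∞ := SNormLESNormFDerivOfEqConst ℝ
    (volume : Measure (EuclideanSpace ℝ (Fin N))) s * ENNReal.ofReal a₀ ^ (1 / (s : ℝ) - 1 / p)
  have hD : D ≠ ⊤ := ENNReal.mul_ne_top ENNReal.coe_ne_top
    (ENNReal.rpow_ne_top_of_nonneg hexp ENNReal.ofReal_ne_top)
  have hB : D ^ p * ENNReal.ofReal a * 2 ≠ ⊤ := ENNReal.mul_ne_top (ENNReal.mul_ne_top
    (ENNReal.rpow_ne_top_of_nonneg hp0.le hD) ENNReal.ofReal_ne_top) ENNReal.ofNat_ne_top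
  obtain ⟨C, hC, hzero⟩ := exists_eq_zero_of_deGiorgi_recursion_ennreal hp0 hpr hq hqr hB
    (ENNReal.mul_ne_top hD (ENNReal.ofReal_ne_top (r := a₀)))
    (zero_le_one.trans (le_max_right m₀ 1))
  refine ⟨C, hC, fun Ω hΩ u g h henergy hmax ↦ ?_⟩
  obtain ⟨hvol, hnorm⟩ := max_le_iff.1 hmax
  have hsob {m : ℝ} (hm : max m₀ 1 ≤ m) :
      eLpNorm (fun x ↦ max (u x - m) 0) r (volume.restrict Ω) ≤
        D * eLpNorm g (ENNReal.ofReal p) (volume.restrict (superlevel Ω u m)) := by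
    obtain ⟨hm₀, hm1⟩ := max_le_iff.1 hm
    exact h.eLpNorm_truncation_le_of_volume_le hΩ (by lia) hs hsp hsr (by linarith)
      ((measure_mono (superlevel_anti Ω u hm₀)).trans hvol)
  have hgrad (m : ℝ) : eLpNorm g (ENNReal.ofReal p) (volume.restrict (superlevel Ω u m)) ≤
      ENNReal.ofReal a₀ := (eLpNorm_mono_measure _ (Measure.restrict_mono (fun x hx ↦ hx.1)
    le_rfl)).trans ((eLpNorm_le_sobolevNorm Ω hp0 u g).2.trans hnorm)
  refine ae_le_of_eLpNorm_truncation_eq_zero h.memW1p.memLp.1 hr0 (hzero _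
    (antitone_eLpNorm_truncation _ u r) ((hsob le_rfl).trans (mul_le_mul_right (hgrad _) D))
    fun m h' hm hmh ↦ ?_)
  have hm' := hm.trans hmh.le
  exact deGiorgi_recursion_of_energy_superlevel hΩ h.memW1p.memLp.1 hp0 hq hqr
    (zero_le_one.trans ((le_max_right _ _).trans hm)) hmh (hsob hm')
    (henergy h' ((le_max_left _ _).trans hm'))

theorem gradient_fun_neg {E : Type*} [NormedAddCommGroup E] [InnerProductSpace ℝ E]
    [CompleteSpace E] (f : E → ℝ) (x : E) : gradient (fun y ↦ -f y) x = -gradient f x := by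
  simp [gradient, fderiv_fun_neg]

section Neg

variable {N : ℕ} {Ω : Set (EuclideanSpace ℝ (Fin N))} {p : ℝ}
  {u : EuclideanSpace ℝ (Fin N) → ℝ} {g : EuclideanSpace ℝ (Fin N) → EuclideanSpace ℝ (Fin N)}

theorem sublevel_eq_superlevel_neg (m : ℝ) :
    sublevel Ω u m = superlevel Ω (fun x ↦ -u x) m := by
  ext x; simp [sublevel, superlevel, lt_neg]

theorem sobolevNorm_neg :
    sobolevNorm Ω p (fun x ↦ -u x) (fun x ↦ -g x) = sobolevNorm Ω p u g := by
  simp [sobolevNorm]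

theorem IsTestFunction.neg {φ : EuclideanSpace ℝ (Fin N) → ℝ} (h : IsTestFunction Ω φ) :
    IsTestFunction Ω (fun x ↦ -φ x) where
  smooth := h.smooth.neg
  compact_support := h.compact_support.neg
  support_subset := by
    rw [tsupport, Function.support_fun_neg]; exact h.support_subset

theorem MemW01p.neg (h : MemW01p Ω p u g) : MemW01p Ω p (fun x ↦ -u x) (fun x ↦ -g x) where
  memW1p :=
    { memLp := h.memW1p.memLp.neg
      memLp_grad := h.memW1p.memLp_grad.neg
      isWeakGradient :=
        { locallyIntegrable := h.memW1p.isWeakGradient.locallyIntegrable.neg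
          locallyIntegrable_grad := h.memW1p.isWeakGradient.locallyIntegrable_grad.neg
          integral_eq := fun φ hφ ↦ by
            simp only [neg_smul, smul_neg, integral_neg]
            rw [h.memW1p.isWeakGradient.integral_eq φ hφ] } }
  exists_approx := fun ε hε ↦ by
    obtain ⟨φ, hφ, hlt⟩ := h.exists_approx ε hε
    refine ⟨fun x ↦ -φ x, hφ.neg, ?_⟩
    simp only [gradient_fun_neg, ← neg_sub']
    rwa [sobolevNorm_neg]

end Neg

theorem lemma5p6_general {N : ℕ} {p q : ℝ} (hN : 2 ≤ N) (hp : 1 ≤ p) (hq : 0 ≤ q)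
    (hq' : (q : EReal) < sobolevExponent N p) (a a₀ m₀ : ℝ) :
    ∃ C : ℝ, 0 < C ∧
      ∀ (Ω : Set (EuclideanSpace ℝ (Fin N))), MeasurableSet Ω →
      ∀ (u : EuclideanSpace ℝ (Fin N) → ℝ)
        (g : EuclideanSpace ℝ (Fin N) → EuclideanSpace ℝ (Fin N)), MemW01p Ω p u g →
        ((∀ m : ℝ, m₀ ≤ m →
            ∫⁻ x in superlevel Ω u m, ‖g x‖ₑ ^ p ≤
              ENNReal.ofReal a * (ENNReal.ofReal (m ^ q) * volume (superlevel Ω u m) +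
                ∫⁻ x in superlevel Ω u m, ‖u x‖ₑ ^ q)) →
          max (volume (superlevel Ω u m₀)) (sobolevNorm Ω p u g) ≤ ENNReal.ofReal a₀ →
          essSup (fun x => (u x : EReal)) (volume.restrict Ω) ≤ (C : EReal)) ∧
        ((∀ m : ℝ, m₀ ≤ m →
            ∫⁻ x in sublevel Ω u m, ‖g x‖ₑ ^ p ≤
              ENNReal.ofReal a * (ENNReal.ofReal (m ^ q) * volume (sublevel Ω u m) +
                ∫⁻ x in sublevel Ω u m, ‖u x‖ₑ ^ q)) →
          max (volume (sublevel Ω u m₀)) (sobolevNorm Ω p u g) ≤ ENNReal.ofReal a₀ →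
          essSup (fun x => ((-u x : ℝ) : EReal)) (volume.restrict Ω) ≤ (C : EReal)) := by
  obtain ⟨C, hC, hbound⟩ := exists_ae_le_of_energy_superlevel hN hp hq hq' a a₀ m₀
  refine ⟨C, hC, fun Ω hΩ u g h ↦ ⟨fun henergy hmax ↦ ?_, fun henergy hmax ↦ ?_⟩⟩
  · exact essSup_le_of_ae_le _ ((hbound Ω hΩ u g h henergy hmax).mono fun x hx ↦
      EReal.coe_le_coe_iff.2 hx)
  · simp only [sublevel_eq_superlevel_neg] at henergy hmax
    refine essSup_le_of_ae_le _ ((hbound Ω hΩ _ _ h.neg (fun m hm ↦ ?_) ?_).mono fun x hx ↦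
      EReal.coe_le_coe_iff.2 hx)
    · simpa only [enorm_neg] using henergy m hm
    · rwa [sobolevNorm_neg]

theorem lemma5p6 (N m₀ : ℕ) (p q a a₀ : ℝ) (hp : 1 < p) (hpN : p ≤ N) (hpq : p ≤ q)
    (hq : (q : EReal) < sobolevExponent N p) (ha : 0 < a) (hm₀ : 1 ≤ m₀) (ha₀ : 0 < a₀) :
    ∃ C : ℝ, 0 < C ∧
      ∀ (Ω : Set (EuclideanSpace ℝ (Fin N))), IsOpen Ω → Bornology.IsBounded Ω →
      ∀ (u : EuclideanSpace ℝ (Fin N) → ℝ)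
        (g : EuclideanSpace ℝ (Fin N) → EuclideanSpace ℝ (Fin N)), MemW01p Ω p u g →
        ((∀ m : ℝ, (m₀ : ℝ) ≤ m →
            ∫⁻ x in superlevel Ω u m, ‖g x‖ₑ ^ p ≤
              ENNReal.ofReal a * (ENNReal.ofReal (m ^ q) * volume (superlevel Ω u m) +
                ∫⁻ x in superlevel Ω u m, ‖u x‖ₑ ^ q)) →
          max (volume (superlevel Ω u m₀)) (sobolevNorm Ω p u g) ≤ ENNReal.ofReal a₀ →
          essSup (fun x => (u x : EReal)) (volume.restrict Ω) ≤ (C : EReal)) ∧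
        ((∀ m : ℝ, (m₀ : ℝ) ≤ m →
            ∫⁻ x in sublevel Ω u m, ‖g x‖ₑ ^ p ≤
              ENNReal.ofReal a * (ENNReal.ofReal (m ^ q) * volume (sublevel Ω u m) +
                ∫⁻ x in sublevel Ω u m, ‖u x‖ₑ ^ q)) →
          max (volume (sublevel Ω u m₀)) (sobolevNorm Ω p u g) ≤ ENNReal.ofReal a₀ →
          essSup (fun x => ((-u x : ℝ) : EReal)) (volume.restrict Ω) ≤ (C : EReal)) := by
  obtain ⟨C, hC, hbound⟩ := lemma5p6_general (by exact_mod_cast hp.trans_le hpN) hp.le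
    (by linarith) hq a a₀ m₀
  exact ⟨C, hC, fun Ω hΩ _ ↦ hbound Ω hΩ.measurableSet⟩
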